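/- Let $\mathcal A$ be a von Neumann algebra and let $E$ be an $\mathcal A$-$W^*$-correspondence, that is, a right Hilbert $C^*$-module over $\mathcal A$ (with $\mathcal A$-valued inner product $\langle\cdot,\cdot\rangle$ linear in the first variable) with a left action $\varphi$ of $\mathcal A$ by adjointable operators satisfying $\langle \varphi(a)e,f\rangle=\langle e,\varphi(a^*)f\rangle$, and which is self-dual: every bounded right $\mathcal A$-module map $E\to\mathcal A$ is of the form $e\mapsto\langle e,f\rangle$ for some $f\in E$. Let $\mathcal E$ be a Hilbert space and $\sigma:\mathcal A\to\mathcal L(\mathcal E)$ a nondegenerate (i.e. unital) $*$-homomorphism, with commutant $\sigma(\mathcal A)'$. For each $n\ge 0$ let $E^{\otimes n}\otimes_\sigma\mathcal E$ be the (completed, balanced) interior tensor product, a Hilbert space, where $\langle e\otimes h,e'\otimes h'\rangle=\langle\langle e,e'\rangle\cdot h,h'\rangle$, with $E^{\otimes 0}\otimes_\sigma\mathcal E=\mathcal E$ and $E^{\otimes (n+1)}\otimes_\sigma\mathcal E=E\otimes_{\mathcal A}(E^{\otimes n}\otimes_\sigma\mathcal E)$, and let $\mathcal F^2(E,\sigma)=\bigoplus_{n\ge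 0}E^{\otimes n}\otimes_\sigma\mathcal E$ (Hilbert space direct sum). For $b\in\sigma(\mathcal A)'$ let $\iota_{\infty,\sigma}(b)=\bigoplus_n (I_{E^{\otimes n}}\otimes b)$ on $\mathcal F^2(E,\sigma)$. Let $E^\sigma$ be the set of bounded operators $\mu:\mathcal E\to E\otimes_\sigma\mathcal E$ with $\mu\sigma(a)=(\varphi(a)\otimes I_{\mathcal E})\mu$ for all $a\in\mathcal A$, let $(E^\sigma)^*=\{\eta:\eta^*\in E^\sigma\}$, and let $\mathbb D((E^\sigma)^*)=\{\eta\in(E^\sigma)^*:\|\eta\|<1\}$. For $\eta\in(E^\sigma)^*$ put $\eta^0=I_{\mathcal E}$ and $\eta^n=\eta(I_E\otimes\eta)\cdots(I_{E^{\otimes (n-1)}}\otimes\eta):E^{\otimes n}\otimes_\sigma\mathcal E\to\mathcal E$. For $f=\bigoplus_n f_n\in\mathcal F^2(E,\sigma)$, $\eta\in\mathbb D((E^\sigma)^*)$ and $b\in\sigma(\mathcal A)'$ put $$f^\wedge(\eta,b)=\sum_{n=0}^\infty\eta^n(I_{E^{\otimes n}}\otimes b)f_n .$$ Let $\Phi:f\mapsto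 f^\wedge$ and $H^2(E,\sigma)=\{f^\wedge:f\in\mathcal F^2(E,\sigma)\}$, a space of $\mathcal E$-valued functions on $\mathbb D((E^\sigma)^*)\times\sigma(\mathcal A)'$, with the norm $\|f^\wedge\|=\|P_{(\ker\Phi)^\perp}f\|$. **Theorem.** The series defining $f^\wedge(\eta,b)$ converges, the norm on $H^2(E,\sigma)$ is a Hilbert space norm, and $\Phi:\mathcal F^2(E,\sigma)\to H^2(E,\sigma)$ is a coisometry. Moreover $H^2(E,\sigma)$ is a reproducing kernel Hilbert correspondence over $\sigma(\mathcal A)'$ with coefficient space $\mathcal E$, whose kernel is the Szegő kernel. Precisely, there are a $*$-representation $\pi$ of $\sigma(\mathcal A)'$ on $H^2(E,\sigma)$ and a function $\mathbb K_{E,\sigma}:\mathbb D((E^\sigma)^*)\times\mathbb D((E^\sigma)^*)\to\mathcal L(\sigma(\mathcal A)',\mathcal L(\mathcal E))$ such that: 1. for all $b,b'\in\sigma(\mathcal A)'$, $\eta'\in\mathbb D((E^\sigma)^*)$ and $f\in\mathcal F^2(E,\sigma)$, $(\pi(b)f^\wedge)(\eta',b')=(\iota_{\infty,\sigma}(b)f)^\wedge(\eta',b')=f^\wedge(\eta',b'b)$;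 2. for all $\zeta\in\mathbb D((E^\sigma)^*)$ and $e\in\mathcal E$ the function $k_\zeta e:(\eta',b')\mapsto\mathbb K_{E,\sigma}(\eta',\zeta)[b']e$ belongs to $H^2(E,\sigma)$, and $\langle F,\pi(b)^*k_\zeta e\rangle_{H^2(E,\sigma)}=\langle F(\zeta,b),e\rangle_{\mathcal E}$ for all $F\in H^2(E,\sigma)$ and $b\in\sigma(\mathcal A)'$; 3. $\mathbb K_{E,\sigma}$ is completely positive: $\sum_{i,j=1}^N\langle\mathbb K_{E,\sigma}(\eta_i,\eta_j)[b_i^*b_j]e_j,e_i\rangle\ge 0$ for all finite families $\eta_i\in\mathbb D((E^\sigma)^*)$, $b_i\in\sigma(\mathcal A)'$, $e_i\in\mathcal E$; 4. for all $\eta,\zeta\in\mathbb D((E^\sigma)^*)$ and $b\in\sigma(\mathcal A)'$, $$\mathbb K_{E,\sigma}(\eta,\zeta)[b]=\sum_{n=0}^\infty\eta^n(I_{E^{\otimes n}}\otimes b)(\zeta^n)^*,$$ with convergence in operator norm. -/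

import Mathlib

open scoped TensorProduct InnerProductSpace ComplexOrder

universe u v

namespace FockHardy

set_option linter.unusedSectionVars false

/-- Auxiliary fact: a self-adjoint element of a `C*`-algebra, its negative part, and a square root
of the cube of the negative part. -/
theorem exists_negPart_cube {R : Type*} [CStarAlgebra R] [PartialOrder R] [StarOrderedRing R]
    (x : R) (hx : IsSelfAdjoint x) :
    ∃ y w : R, IsSelfAdjoint y ∧ y * x * y = -(y * y * y) ∧ y * y * y = star w * w ∧
      (y * y * y = 0 → ∃ z, x = star z * z) := by
  have h1 := CFC.posPart_sub_negPart x hx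
  have h2 : x⁻ * x⁺ = 0 := CFC.negPart_mul_posPart x
  have hn : 0 ≤ x⁻ := CFC.negPart_nonneg x
  have hs : IsSelfAdjoint x⁻ := IsSelfAdjoint.of_nonneg hn
  obtain ⟨w, hw⟩ := CStarAlgebra.nonneg_iff_eq_star_mul_self.1 (hs.conjugate_nonneg hn)
  refine ⟨x⁻, w, hs, ?_, hw, fun h => ?_⟩
  · conv_lhs => rw [show x⁻ * x * x⁻ = x⁻ * (x⁺ - x⁻) * x⁻ by rw [h1]]
    rw [mul_sub, h2]; noncomm_ring
  · have h3 : x⁻ * x⁻ = 0 := by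
      apply CStarRing.star_mul_self_eq_zero_iff _ |>.1
      rw [(show IsSelfAdjoint (x⁻ * x⁻) by
        simpa [hs.star_eq] using IsSelfAdjoint.star_mul_self x⁻).star_eq, ← mul_assoc, h, zero_mul]
    have h4 : x⁻ = 0 := by
      apply CStarRing.star_mul_self_eq_zero_iff _ |>.1
      rw [hs.star_eq, h3]
    have : 0 ≤ x := by rw [← h1, h4, sub_zero]; exact CFC.posPart_nonneg x
    exact CStarAlgebra.nonneg_iff_eq_star_mul_self.1 this

/-- A matrix `G` over a `C*`-algebra with `∑ vᵢ* Gᵢⱼ vⱼ ≥ 0` for all `v` is of the form `X* X`. -/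
theorem matrix_factor {n : Type*} [Fintype n] {A : Type*} [CStarAlgebra A] [PartialOrder A]
    [StarOrderedRing A] (G : Matrix n n A) (hs : ∀ i j, star (G i j) = G j i)
    (hG : ∀ v : n → A, 0 ≤ ∑ i, ∑ j, star (v i) * G i j * v j) :
    ∃ X : Matrix n n A, ∀ i j, G i j = ∑ k, star (X k i) * X k j := by
  classical
  have hM : IsSelfAdjoint (CStarMatrix.ofMatrix G) := by
    ext i j; simpa [CStarMatrix.star_apply] using hs j i
  obtain ⟨Y, Z, hY, h1, hZ, h3⟩ := exists_negPart_cube (CStarMatrix.ofMatrix G) hM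
  have hYs : ∀ i j, star (Y i j) = Y j i := fun i j => by
    rw [← CStarMatrix.star_apply, hY.star_eq]
  have key : ∀ j, ∑ k, star (Z k j) * Z k j = 0 := by
    intro j
    apply le_antisymm _ (Finset.sum_nonneg fun k _ => star_mul_self_nonneg _)
    have e1 : (Y * Y * Y) j j = ∑ k, star (Z k j) * Z k j := by
      rw [hZ]; simp [CStarMatrix.mul_apply, CStarMatrix.star_apply]
    have e2 := hG (fun i => Y i j)
    have e3 : ∑ i, ∑ k, star (Y i j) * G i k * Y k j = (Y * CStarMatrix.ofMatrix G * Y) j j := by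
      simp only [CStarMatrix.mul_apply, hYs, Finset.sum_mul]
      rw [Finset.sum_comm]; rfl
    rw [e3, h1] at e2
    rw [← e1]
    simpa using e2
  have hZ0 : Z = 0 := by
    ext k j
    have := (Finset.sum_eq_zero_iff_of_nonneg
      (fun k _ => star_mul_self_nonneg (Z k j))).1 (key j) k (Finset.mem_univ _)
    simpa using (CStarRing.star_mul_self_eq_zero_iff _).1 this
  obtain ⟨X, hX⟩ := h3 (by rw [hZ, hZ0]; simp)
  refine ⟨fun i j => X i j, fun i j => ?_⟩
  have := congrFun (congrFun hX i) j
  simpa [CStarMatrix.mul_apply, CStarMatrix.star_apply] using this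

/-- The structure of an `A`-correspondence on the Banach space `E`: the right action of `A` is
written `op a • e`, the left action `a • e`, and `ip` is the `A`-valued inner product, linear in
the first variable. -/
class Correspondence (A E : Type*) [CStarAlgebra A] [PartialOrder A] [NormedAddCommGroup E]
    [NormedSpace ℂ E] [CompleteSpace E] [Module A E] [Module Aᵐᵒᵖ E] [SMulCommClass A Aᵐᵒᵖ E]
    [IsScalarTower ℂ A E] [IsScalarTower ℂ Aᵐᵒᵖ E] where
  ip : E → E → A
  ip_add_left : ∀ e f g, ip (e + f) g = ip e g + ip f g
  ip_smul_left : ∀ (c : ℂ) (e f : E), ip (c • e) f = c • ip e f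
  ip_op_smul_left : ∀ (a : A) (e f : E), ip (MulOpposite.op a • e) f = ip e f * a
  star_ip : ∀ e f, star (ip e f) = ip f e
  ip_self_nonneg : ∀ e, 0 ≤ ip e e
  ip_self_eq_zero : ∀ e, ip e e = 0 → e = 0
  norm_eq : ∀ e, ‖e‖ = √‖ip e e‖
  ip_left_action : ∀ (a : A) (e f : E), ip (a • e) f = ip e (star a • f)

/-- A (nondegenerate) `(A, ℂ)`-correspondence: a Hilbert space with a unital `*`-representation. -/
structure HilbertRep (A : Type v) [CStarAlgebra A] : Type (max (u + 1) v) where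
  carrier : Type u
  [normedAddCommGroup : NormedAddCommGroup carrier]
  [innerProductSpace : InnerProductSpace ℂ carrier]
  [completeSpace : CompleteSpace carrier]
  rep : A →⋆ₐ[ℂ] (carrier →L[ℂ] carrier)

attribute [instance] HilbertRep.normedAddCommGroup HilbertRep.innerProductSpace
  HilbertRep.completeSpace

/-- Bounded `A`-module maps between `(A, ℂ)`-correspondences. -/
structure ModuleMap {A : Type v} [CStarAlgebra A] (V W : HilbertRep.{u} A) where
  toCLM : V.carrier →L[ℂ] W.carrier
  map_rep : ∀ a, toCLM ∘L V.rep a = W.rep a ∘L toCLM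

section Tensor

variable {A : Type v} [CStarAlgebra A] [PartialOrder A] [StarOrderedRing A]
  (E : Type u) [NormedAddCommGroup E] [NormedSpace ℂ E] [CompleteSpace E] [Module A E]
  [Module Aᵐᵒᵖ E] [SMulCommClass A Aᵐᵒᵖ E] [IsScalarTower ℂ A E] [IsScalarTower ℂ Aᵐᵒᵖ E]
  [Correspondence A E]

open Correspondence

theorem ip_add_right (e f g : E) : (ip e (f + g) : A) = ip e f + ip e g := by
  rw [← star_ip, ip_add_left, star_add, star_ip, star_ip]

theorem ip_smul_right (c : ℂ) (e f : E) : (ip e (c • f) : A) = star c • ip e f := by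
  rw [← star_ip, ip_smul_left, star_smul, star_ip]

theorem ip_op_smul_right (a : A) (e f : E) :
    (ip e (MulOpposite.op a • f) : A) = star a * ip e f := by
  rw [← star_ip, ip_op_smul_left, star_mul, star_ip]

theorem ip_sum_left {ι : Type*} (s : Finset ι) (e : ι → E) (f : E) :
    (ip (∑ i ∈ s, e i) f : A) = ∑ i ∈ s, ip (e i) f :=
  map_sum (AddMonoidHom.mk' (fun x => (ip x f : A)) fun x y => ip_add_left x y f) e s

theorem ip_sum_right {ι : Type*} (s : Finset ι) (e : ι → E) (f : E) :
    (ip f (∑ i ∈ s, e i) : A) = ∑ i ∈ s, ip f (e i) :=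
  map_sum (AddMonoidHom.mk' (fun x => (ip f x : A)) fun x y => ip_add_right E f x y) e s

/-- Gram matrices are positive: `⟨eⱼ, eᵢ⟩ = (X* X)ᵢⱼ`. -/
theorem gram_factor {n : Type*} [Fintype n] (e : n → E) :
    ∃ X : Matrix n n A, ∀ i j, ip (e j) (e i) = ∑ k, star (X k i) * X k j := by
  refine matrix_factor (fun i j => ip (e j) (e i)) (fun i j => star_ip _ _) fun v => ?_
  have := ip_self_nonneg (A := A) (∑ j, MulOpposite.op (v j) • e j)
  rw [ip_sum_right] at this
  simpa only [ip_sum_left, ip_op_smul_right, ip_op_smul_left, Finset.mul_sum, mul_assoc] using this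

variable (V W : HilbertRep.{u} A)

/-- The algebraic tensor product of `E` and the Hilbert space of `V`, which carries the semi-inner
product of the interior tensor product. -/
def PreTensor : Type u := E ⊗[ℂ] V.carrier

noncomputable instance : AddCommGroup (PreTensor E V) :=
  inferInstanceAs (AddCommGroup (E ⊗[ℂ] V.carrier))

noncomputable instance : Module ℂ (PreTensor E V) :=
  inferInstanceAs (Module ℂ (E ⊗[ℂ] V.carrier))

/-- The functional `e ⊗ h ↦ ⟨⟨e, e'⟩ h, h'⟩`. -/
noncomputable def pairing (e' : E) (h' : V.carrier) : E ⊗[ℂ] V.carrier →ₗ[ℂ] ℂ :=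
  TensorProduct.lift <| LinearMap.mk₂ ℂ (fun e h => ⟪h', V.rep (ip e e') h⟫_ℂ)
    (by intros; simp [ip_add_left])
    (by intros; simp [ip_smul_left])
    (by intros; simp)
    (by intros; simp)

/-- The sesquilinear form `(e' ⊗ h', e ⊗ h) ↦ ⟨⟨e, e'⟩ h, h'⟩`. -/
noncomputable def tensorForm : E ⊗[ℂ] V.carrier →ₗ⋆[ℂ] E ⊗[ℂ] V.carrier →ₗ[ℂ] ℂ :=
  TensorProduct.lift <| LinearMap.mk₂'ₛₗ (starRingEnd ℂ) (starRingEnd ℂ) (pairing E V)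
    (by intros; ext; simp [pairing, ip_add_right])
    (by intros; ext; simp [pairing, ip_smul_right])
    (by intros; ext; simp [pairing])
    (by intros; ext; simp [pairing, mul_comm])

theorem tensorForm_tmul (e e' : E) (h h' : V.carrier) :
    tensorForm E V (e' ⊗ₜ h') (e ⊗ₜ h) = ⟪h', V.rep (ip e e') h⟫_ℂ := rfl

theorem rep_adjoint (a : A) (x y : V.carrier) :
    ⟪V.rep (star a) x, y⟫_ℂ = ⟪x, V.rep a y⟫_ℂ := by
  rw [map_star, ContinuousLinearMap.star_eq_adjoint, ContinuousLinearMap.adjoint_inner_left]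

theorem tensorForm_sum_self {n : Type*} [Fintype n] (e : n → E) (h : n → V.carrier)
    (X : Matrix n n A) (hX : ∀ i j, ip (e j) (e i) = ∑ k, star (X k i) * X k j) :
    tensorForm E V (∑ i, e i ⊗ₜ h i) (∑ i, e i ⊗ₜ h i) =
      ((∑ k, ‖∑ i, V.rep (X k i) (h i)‖ ^ 2 : ℝ) : ℂ) := by
  have : ∀ k, ((‖∑ i, V.rep (X k i) (h i)‖ ^ 2 : ℝ) : ℂ) =
      ∑ i, ∑ j, ⟪h i, V.rep (star (X k i) * X k j) (h j)⟫_ℂ := by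
    intro k
    have := inner_self_eq_norm_sq_to_K (𝕜 := ℂ) (∑ i, V.rep (X k i) (h i))
    push_cast
    erw [← this]
    simp only [sum_inner, inner_sum, map_mul, mul_apply_eq_comp]
    rw [Finset.sum_comm]
    refine Finset.sum_congr rfl fun i _ => Finset.sum_congr rfl fun j _ => ?_
    rw [← rep_adjoint V (star (X k i)), star_star]
  rw [Complex.ofReal_sum]
  simp only [this, map_sum, LinearMap.sum_apply, tensorForm_tmul, hX,
    _root_.sum_apply, inner_sum]
  symm
  calc _ = ∑ i, ∑ k, ∑ j, ⟪h i, V.rep (star (X k i) * X k j) (h j)⟫_ℂ := Finset.sum_comm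
    _ = ∑ i, ∑ j, ∑ k, ⟪h i, V.rep (star (X k i) * X k j) (h j)⟫_ℂ :=
      Finset.sum_congr rfl fun i _ => Finset.sum_comm
    _ = _ := Finset.sum_comm

theorem tensorForm_symm (x y : E ⊗[ℂ] V.carrier) :
    starRingEnd ℂ (tensorForm E V y x) = tensorForm E V x y := by
  induction x using TensorProduct.induction_on with
  | zero => simp
  | add a b ha hb => simp [ha, hb]
  | tmul e h =>
    induction y using TensorProduct.induction_on with
    | zero => simp
    | add a b ha hb => simp [ha, hb]
    | tmul e' h' =>
      rw [tensorForm_tmul, tensorForm_tmul, inner_conj_symm, ← rep_adjoint V, star_ip]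

theorem tensorForm_self_nonneg (x : E ⊗[ℂ] V.carrier) : 0 ≤ (tensorForm E V x x).re := by
  obtain ⟨k, e, h, rfl⟩ := TensorProduct.exists_sum_tmul_eq x
  obtain ⟨X, hX⟩ := gram_factor (A := A) E e
  rw [tensorForm_sum_self E V e h X hX, Complex.ofReal_re]
  exact Finset.sum_nonneg fun _ _ => sq_nonneg _

noncomputable instance PreTensor.core : PreInnerProductSpace.Core ℂ (PreTensor E V) where
  inner x y := tensorForm E V x y
  conj_inner_symm := tensorForm_symm E V
  re_inner_nonneg := tensorForm_self_nonneg E V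
  add_left x y z := by
    exact LinearMap.map_add₂ (tensorForm E V) x y z
  smul_left x y c := by
    exact LinearMap.map_smulₛₗ₂ (tensorForm E V) c x y

noncomputable instance : SeminormedAddCommGroup (PreTensor E V) :=
  InnerProductSpace.Core.toSeminormedAddCommGroup (𝕜 := ℂ)

noncomputable instance : InnerProductSpace ℂ (PreTensor E V) := .ofCore _

theorem PreTensor.norm_sq (x : PreTensor E V) : ‖x‖ ^ 2 = (tensorForm E V x x).re :=
  norm_sq_eq_re_inner (𝕜 := ℂ) x

variable {V W}

theorem tensorForm_map_le (T : ModuleMap V W) (x : E ⊗[ℂ] V.carrier) :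
    (tensorForm E W (T.toCLM.toLinearMap.lTensor E x) (T.toCLM.toLinearMap.lTensor E x)).re ≤
      ‖T.toCLM‖ ^ 2 * (tensorForm E V x x).re := by
  obtain ⟨k, e, h, rfl⟩ := TensorProduct.exists_sum_tmul_eq x
  obtain ⟨X, hX⟩ := gram_factor (A := A) E e
  have hT : ∀ a y, W.rep a (T.toCLM y) = T.toCLM (V.rep a y) := fun a y =>
    (congrArg (fun S => S y) (T.map_rep a)).symm
  rw [map_sum (T.toCLM.toLinearMap.lTensor E)]
  simp only [LinearMap.lTensor_tmul, ContinuousLinearMap.coe_coe]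
  rw [tensorForm_sum_self E V e h X hX, tensorForm_sum_self E W e (fun i => T.toCLM (h i)) X hX, Complex.ofReal_re, Complex.ofReal_re,
    Finset.mul_sum]
  refine Finset.sum_le_sum fun k _ => ?_
  simp only [hT, ← map_sum, ← mul_pow]
  gcongr
  exact T.toCLM.le_opNorm _

/-- `I_E ⊗ T` on the algebraic tensor product. -/
noncomputable def preAmplify (T : ModuleMap V W) : PreTensor E V →L[ℂ] PreTensor E W :=
  LinearMap.mkContinuous (𝕜 := ℂ) (𝕜₂ := ℂ) (E := PreTensor E V) (F := PreTensor E W)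
    (T.toCLM.toLinearMap.lTensor E) ‖T.toCLM‖ fun x => by
      refine le_of_sq_le_sq ?_ (by positivity)
      rw [mul_pow, PreTensor.norm_sq, PreTensor.norm_sq]
      exact tensorForm_map_le E T x

variable (V)

theorem tensorForm_act (a : A) (x y : E ⊗[ℂ] V.carrier) :
    tensorForm E V ((Algebra.lsmul ℂ ℂ E a).rTensor V.carrier x) y =
      tensorForm E V x ((Algebra.lsmul ℂ ℂ E (star a)).rTensor V.carrier y) := by
  induction x using TensorProduct.induction_on with
  | zero => simp
  | add a b ha hb => simp [ha, hb]
  | tmul e h =>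
    induction y using TensorProduct.induction_on with
    | zero => simp
    | add a b ha hb => rw [map_add, map_add, map_add, ha, hb]
    | tmul e' h' => simp [tensorForm_tmul, ip_left_action]

theorem tensorForm_act_le (a : A) (x : E ⊗[ℂ] V.carrier) :
    (tensorForm E V ((Algebra.lsmul ℂ ℂ E a).rTensor V.carrier x)
      ((Algebra.lsmul ℂ ℂ E a).rTensor V.carrier x)).re ≤ ‖a‖ ^ 2 * (tensorForm E V x x).re := by
  have h0 : 0 ≤ algebraMap ℝ A (‖a‖ ^ 2) - star a * a := by
    rw [sub_nonneg, sq, ← CStarRing.norm_star_mul_self]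
    exact (IsSelfAdjoint.star_mul_self a).le_algebraMap_norm_self
  obtain ⟨c, hc⟩ := CStarAlgebra.nonneg_iff_eq_star_mul_self.1 h0
  have h1 := tensorForm_self_nonneg E V ((Algebra.lsmul ℂ ℂ E c).rTensor V.carrier x)
  rw [tensorForm_act, ← LinearMap.rTensor_comp_apply, ← Module.End.mul_eq_comp, ← map_mul,
    ← hc] at h1
  rw [tensorForm_act, ← LinearMap.rTensor_comp_apply, ← Module.End.mul_eq_comp, ← map_mul]
  have h2 : Algebra.lsmul ℂ ℂ E (algebraMap ℝ A (‖a‖ ^ 2)) = ((‖a‖ ^ 2 : ℝ) : ℂ) • LinearMap.id := by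
    ext e
    simp [Algebra.algebraMap_eq_smul_one, -Complex.ofReal_pow]
  rw [map_sub, h2, LinearMap.rTensor_sub, LinearMap.rTensor_smul, LinearMap.rTensor_id] at h1
  simp only [LinearMap.sub_apply, LinearMap.smul_apply, LinearMap.id_apply, map_sub, map_smul,
    Complex.sub_re, smul_eq_mul, Complex.re_ofReal_mul] at h1
  linarith

/-- `φ(a) ⊗ I` on the algebraic tensor product. -/
noncomputable def preAct (a : A) : PreTensor E V →L[ℂ] PreTensor E V :=
  LinearMap.mkContinuous (𝕜 := ℂ) (𝕜₂ := ℂ) (E := PreTensor E V) (F := PreTensor E V)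
    ((Algebra.lsmul ℂ ℂ E a).rTensor V.carrier) ‖a‖ fun x => by
      refine le_of_sq_le_sq ?_ (by positivity)
      rw [mul_pow, PreTensor.norm_sq, PreTensor.norm_sq]
      exact tensorForm_act_le E V a x

open UniformSpace (Completion)

theorem completion_ext {F G : Type*} [SeminormedAddCommGroup F] [NormedSpace ℂ F]
    [NormedAddCommGroup G] [NormedSpace ℂ G] {S T : Completion F →L[ℂ] G}
    (h : ∀ x : F, S x = T x) : S = T :=
  ContinuousLinearMap.ext fun x => by
    induction x using Completion.induction_on with
    | hp => exact isClosed_eq S.continuous T.continuous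
    | ih x => exact h x

theorem preAct_one (x : PreTensor E V) : preAct E V 1 x = x := by
  have : (Algebra.lsmul ℂ ℂ E (1 : A)).rTensor V.carrier = LinearMap.id := by
    rw [map_one]; exact LinearMap.rTensor_id _ _
  exact congrArg (fun f : E ⊗[ℂ] V.carrier →ₗ[ℂ] E ⊗[ℂ] V.carrier => f x) this

theorem preAct_mul (a b : A) (x : PreTensor E V) :
    preAct E V (a * b) x = preAct E V a (preAct E V b x) := by
  have : (Algebra.lsmul ℂ ℂ E (a * b)).rTensor V.carrier =
      (Algebra.lsmul ℂ ℂ E a).rTensor V.carrier ∘ₗ (Algebra.lsmul ℂ ℂ E b).rTensor V.carrier := by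
    rw [map_mul]; exact LinearMap.rTensor_comp _ _ _
  exact congrArg (fun f : E ⊗[ℂ] V.carrier →ₗ[ℂ] E ⊗[ℂ] V.carrier => f x) this

theorem preAct_add (a b : A) (x : PreTensor E V) :
    preAct E V (a + b) x = preAct E V a x + preAct E V b x := by
  have : (Algebra.lsmul ℂ ℂ E (a + b)).rTensor V.carrier =
      (Algebra.lsmul ℂ ℂ E a).rTensor V.carrier + (Algebra.lsmul ℂ ℂ E b).rTensor V.carrier := by
    rw [map_add]; exact LinearMap.rTensor_add _ _ _
  exact congrArg (fun f : E ⊗[ℂ] V.carrier →ₗ[ℂ] E ⊗[ℂ] V.carrier => f x) this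

theorem preAct_algebraMap (c : ℂ) (x : PreTensor E V) :
    preAct E V (algebraMap ℂ A c) x = c • x := by
  have : (Algebra.lsmul ℂ ℂ E (algebraMap ℂ A c)).rTensor V.carrier = c • LinearMap.id := by
    rw [AlgHom.commutes, Algebra.algebraMap_eq_smul_one]
    exact (LinearMap.rTensor_smul _ _ _).trans (congrArg _ (LinearMap.rTensor_id _ _))
  exact congrArg (fun f : E ⊗[ℂ] V.carrier →ₗ[ℂ] E ⊗[ℂ] V.carrier => f x) this

theorem preAct_inner (a : A) (x y : PreTensor E V) :
    ⟪preAct E V a x, y⟫_ℂ = ⟪x, preAct E V (star a) y⟫_ℂ :=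
  tensorForm_act E V a x y

theorem preAmplify_preAct (T : ModuleMap V W) (a : A) (x : PreTensor E V) :
    preAmplify E T (preAct E V a x) = preAct E W a (preAmplify E T x) := by
  have : T.toCLM.toLinearMap.lTensor E ∘ₗ (Algebra.lsmul ℂ ℂ E a).rTensor V.carrier =
      (Algebra.lsmul ℂ ℂ E a).rTensor W.carrier ∘ₗ T.toCLM.toLinearMap.lTensor E := by
    rw [LinearMap.lTensor_comp_rTensor, LinearMap.rTensor_comp_lTensor]
  exact congrArg (fun f : E ⊗[ℂ] V.carrier →ₗ[ℂ] E ⊗[ℂ] W.carrier => f x) this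

/-- The interior tensor product `E ⊗_A H`, where `H` is the Hilbert space of `V`: the (Hausdorff)
completion of the algebraic tensor product in the semi-inner product
`⟨e ⊗ h, e' ⊗ h'⟩ = ⟨⟨e, e'⟩ h, h'⟩`, with the left action `a (e ⊗ h) = (a e) ⊗ h`. -/
noncomputable def tensor : HilbertRep.{u} A where
  carrier := Completion (PreTensor E V)
  rep := { AlgHom.ofLinearMap (
    { toFun := fun a => (preAct E V a).completion
      map_add' := fun a b => completion_ext fun x => by
        rw [_root_.add_apply]
        simp only [ContinuousLinearMap.completion_apply_coe, preAct_add, Completion.coe_add]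
      map_smul' := fun c a => completion_ext fun x => by
        rw [Algebra.smul_def]
        simp [preAct_mul, preAct_algebraMap, ContinuousLinearMap.completion_apply_coe] } :
        A →ₗ[ℂ] Completion (PreTensor E V) →L[ℂ] Completion (PreTensor E V))
      (completion_ext fun x => by
        simp [preAct_one, ContinuousLinearMap.completion_apply_coe])
      (fun a b => completion_ext fun x => by
        simp [preAct_mul, mul_apply_eq_comp, ContinuousLinearMap.completion_apply_coe]) with
      map_star' := fun a => by
        change (preAct E V (star a)).completion = star (preAct E V a).completion
        rw [ContinuousLinearMap.star_eq_adjoint, ContinuousLinearMap.eq_adjoint_iff]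
        intro x y
        induction x, y using Completion.induction_on₂ with
        | hp => exact isClosed_eq (by fun_prop) (by fun_prop)
        | ih x y =>
          simp [preAct_inner, ContinuousLinearMap.completion_apply_coe, Completion.inner_coe] }

variable {V}

/-- `I_E ⊗ T` for a module map `T`. -/
noncomputable def amplify (T : ModuleMap V W) : ModuleMap (tensor E V) (tensor E W) where
  toCLM := (preAmplify E T).completion
  map_rep a := completion_ext fun x => by
    change (preAmplify E T).completion ((preAct E V a).completion x) =
      (preAct E W a).completion ((preAmplify E T).completion x)
    simp only [ContinuousLinearMap.completion_apply_coe, preAmplify_preAct]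

theorem amplify_norm_le (T : ModuleMap V W) : ‖(amplify E T).toCLM‖ ≤ ‖T.toCLM‖ := by
  refine ContinuousLinearMap.opNorm_le_bound _ (norm_nonneg _) fun x => ?_
  change Completion (PreTensor E V) at x
  change ‖(preAmplify E T).completion x‖ ≤ ‖T.toCLM‖ * ‖x‖
  induction x using Completion.induction_on with
  | hp => exact isClosed_le (by fun_prop) (by fun_prop)
  | ih x =>
    rw [ContinuousLinearMap.completion_apply_coe, Completion.norm_coe, Completion.norm_coe]
    exact (preAmplify E T).le_of_opNorm_le
      (LinearMap.mkContinuous_norm_le _ (norm_nonneg _) _) x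

end Tensor

section Fock

variable {A : Type v} [CStarAlgebra A] [PartialOrder A] [StarOrderedRing A]
  (E : Type u) [NormedAddCommGroup E] [NormedSpace ℂ E] [CompleteSpace E] [Module A E]
  [Module Aᵐᵒᵖ E] [SMulCommClass A Aᵐᵒᵖ E] [IsScalarTower ℂ A E] [IsScalarTower ℂ Aᵐᵒᵖ E]
  [Correspondence A E]

variable (A) in
/-- Self-duality: every bounded right module map `E → A` is `⟨·, f⟩` for some `f`. -/
def IsSelfDual : Prop :=
  ∀ ρ : E →L[ℂ] A, (∀ (e : E) (a : A), ρ (MulOpposite.op a • e) = ρ e * a) →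
    ∃ f : E, ∀ e, ρ e = Correspondence.ip e f

/-- `E^{⊗ n} ⊗_A V`, as the iterated interior tensor product `E ⊗ (E ⊗ ⋯ (E ⊗ V))`. -/
noncomputable def tensorPow (V : HilbertRep.{u} A) : ℕ → HilbertRep.{u} A
  | 0 => V
  | n + 1 => tensor E (tensorPow V n)

variable {𝓔 : Type u} [NormedAddCommGroup 𝓔] [InnerProductSpace ℂ 𝓔] [CompleteSpace 𝓔]
  (σ : A →⋆ₐ[ℂ] (𝓔 →L[ℂ] 𝓔))

/-- The Hilbert space `𝓔` with the left action `a • y = σ(a) y`. -/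
def ofRep : HilbertRep.{u} A := ⟨𝓔, σ⟩

/-- The commutant `σ(A)'`. -/
noncomputable def commutant : StarSubalgebra ℂ (𝓔 →L[ℂ] 𝓔) := StarSubalgebra.centralizer ℂ (Set.range σ)

instance : IsClosed (commutant σ : Set (𝓔 →L[ℂ] 𝓔)) := Set.isClosed_centralizer _

theorem mem_commutant {b : 𝓔 →L[ℂ] 𝓔} : b ∈ commutant σ ↔ ∀ a, b ∘L σ a = σ a ∘L b := by
  rw [commutant, StarSubalgebra.mem_centralizer_iff]
  constructor
  · intro h a
    exact ((h _ ⟨a, rfl⟩).1).symm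
  · rintro h _ ⟨a, rfl⟩
    refine ⟨(h a).symm, ?_⟩
    rw [← map_star]
    exact (h (star a)).symm

/-- An element of `σ(A)'` as a module map of `𝓔`. -/
noncomputable def commutantMap (b : commutant σ) : ModuleMap (ofRep σ) (ofRep σ) where
  toCLM := (b : 𝓔 →L[ℂ] 𝓔)
  map_rep := (mem_commutant σ).1 b.2

/-- `I_{E^{⊗ n}} ⊗ b` on `E^{⊗ n} ⊗_σ 𝓔`. -/
noncomputable def ampl (b : commutant σ) :
    (n : ℕ) → ModuleMap (tensorPow E (ofRep σ) n) (tensorPow E (ofRep σ) n)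
  | 0 => commutantMap σ b
  | n + 1 => amplify E (ampl b n)

/-- `E^σ`: the bounded operators `μ : 𝓔 → E ⊗_σ 𝓔` with `μ σ(a) = (φ(a) ⊗ I) μ`. -/
def Esigma : Set (𝓔 →L[ℂ] (tensor E (ofRep σ)).carrier) :=
  {μ | ∀ a : A, μ ∘L σ a = (tensor E (ofRep σ)).rep a ∘L μ}

/-- `(E^σ)^*`: the bounded operators `η : E ⊗_σ 𝓔 → 𝓔` with `η^* ∈ E^σ`. -/
def EsigmaStar : Set ((tensor E (ofRep σ)).carrier →L[ℂ] 𝓔) :=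
  {η | ContinuousLinearMap.adjoint η ∈ Esigma E σ}

/-- `𝔻((E^σ)^*)`: the strictly contractive elements of `(E^σ)^*`. -/
def Disc : Type u := {η : (tensor E (ofRep σ)).carrier →L[ℂ] 𝓔 // η ∈ EsigmaStar E σ ∧ ‖η‖ < 1}

variable {E σ}

/-- An element of the disc as a module map `E ⊗_σ 𝓔 → 𝓔`. -/
noncomputable def Disc.moduleMap (η : Disc E σ) : ModuleMap (tensor E (ofRep σ)) (ofRep σ) where
  toCLM := η.1
  map_rep a := by
    have h := congrArg ContinuousLinearMap.adjoint (η.2.1 (star a))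
    rw [ContinuousLinearMap.adjoint_comp, ContinuousLinearMap.adjoint_comp,
      ContinuousLinearMap.adjoint_adjoint, map_star σ a, map_star (tensor E (ofRep σ)).rep a,
      ContinuousLinearMap.star_eq_adjoint, ContinuousLinearMap.star_eq_adjoint,
      ContinuousLinearMap.adjoint_adjoint, ContinuousLinearMap.adjoint_adjoint] at h
    exact h.symm

/-- `I_{E^{⊗ n}} ⊗ η : E^{⊗ (n+1)} ⊗_σ 𝓔 → E^{⊗ n} ⊗_σ 𝓔`. -/
noncomputable def Disc.step (η : Disc E σ) :
    (n : ℕ) → ModuleMap (tensorPow E (ofRep σ) (n + 1)) (tensorPow E (ofRep σ) n)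
  | 0 => η.moduleMap
  | n + 1 => amplify E (η.step n)

/-- The generalized power `η^n = η (I_E ⊗ η) ⋯ (I_{E^{⊗ (n-1)}} ⊗ η) : E^{⊗ n} ⊗_σ 𝓔 → 𝓔`. -/
noncomputable def Disc.power (η : Disc E σ) :
    (n : ℕ) → (tensorPow E (ofRep σ) n).carrier →L[ℂ] 𝓔
  | 0 => ContinuousLinearMap.id ℂ 𝓔
  | n + 1 => η.power n ∘L (η.step n).toCLM

theorem ampl_norm_le (b : commutant σ) (n : ℕ) : ‖(ampl E σ b n).toCLM‖ ≤ ‖b‖ := by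
  induction n with
  | zero => exact le_rfl
  | succ n ih => exact (amplify_norm_le E _).trans ih

theorem Disc.step_norm_le (η : Disc E σ) (n : ℕ) : ‖(η.step n).toCLM‖ ≤ ‖η.1‖ := by
  induction n with
  | zero => exact le_rfl
  | succ n ih => exact (amplify_norm_le E _).trans ih

theorem Disc.power_norm_le (η : Disc E σ) (n : ℕ) : ‖η.power n‖ ≤ ‖η.1‖ ^ n := by
  induction n with
  | zero => rw [pow_zero]; exact ContinuousLinearMap.norm_id_le
  | succ n ih =>
    rw [pow_succ]
    exact (ContinuousLinearMap.opNorm_comp_le _ _).trans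
      (mul_le_mul ih (η.step_norm_le n) (norm_nonneg _) (by positivity))

variable (E σ)

/-- The Fock space `F²(E, σ) = ⨁ₙ E^{⊗ n} ⊗_σ 𝓔` (Hilbert space direct sum). -/
abbrev Fock : Type u := lp (fun n : ℕ => (tensorPow E (ofRep σ) n).carrier) 2

variable {E σ}

/-- The operator `ι_{∞,σ}(b) = I ⊗ b` on the Fock space. -/
noncomputable def iota (b : commutant σ) : Fock E σ →L[ℂ] Fock E σ :=
  have hb (f : Fock E σ) (n : ℕ) :
      ‖(ampl E σ b n).toCLM (f n)‖ ≤ ‖((‖b‖ : ℂ) • f : Fock E σ) n‖ := by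
    rw [lp.coeFn_smul, Pi.smul_apply, norm_smul, Complex.norm_real, norm_norm]
    exact (ampl E σ b n).toCLM.le_of_opNorm_le (ampl_norm_le b n) _
  LinearMap.mkContinuous
    { toFun := fun f => ⟨fun n => (ampl E σ b n).toCLM (f n),
        (lp.memℓp ((‖b‖ : ℂ) • f : Fock E σ)).mono' (hb f)⟩
      map_add' := fun f g => by ext n; simp; rfl
      map_smul' := fun c f => by ext n; simp } ‖b‖ fun f => by
    have := lp.norm_mono (p := 2) (by norm_num) (x := (⟨fun n => (ampl E σ b n).toCLM (f n),
        (lp.memℓp ((‖b‖ : ℂ) • f : Fock E σ)).mono' (hb f)⟩ : Fock E σ))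
      (y := ((‖b‖ : ℂ) • f : Fock E σ)) (hb f)
    rwa [norm_smul, Complex.norm_real, norm_norm] at this

theorem term_norm_le (η : Disc E σ) (b : commutant σ) (f : Fock E σ) (n : ℕ) :
    ‖η.power n ((ampl E σ b n).toCLM (f n))‖ ≤ ‖η.1‖ ^ n * (‖b‖ * ‖f‖) := by
  refine ((η.power n).le_of_opNorm_le (η.power_norm_le n) _).trans ?_
  gcongr
  refine ((ampl E σ b n).toCLM.le_of_opNorm_le (ampl_norm_le b n) _).trans ?_
  gcongr
  exact lp.norm_apply_le_norm (by norm_num) f n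

theorem summable_geom (η : Disc E σ) (C : ℝ) : Summable fun n : ℕ => ‖η.1‖ ^ n * C :=
  (summable_geometric_of_lt_one (norm_nonneg _) η.2.2).mul_right C

theorem summable_term (η : Disc E σ) (b : commutant σ) (f : Fock E σ) :
    Summable fun n => η.power n ((ampl E σ b n).toCLM (f n)) :=
  Summable.of_norm_bounded (summable_geom η _) (term_norm_le η b f)

/-- The point evaluation `f^∧(η, b) = ∑ₙ ηⁿ (I_{E^{⊗ n}} ⊗ b) fₙ`. -/
noncomputable def pointEval (f : Fock E σ) (η : Disc E σ) (b : commutant σ) : 𝓔 :=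
  ∑' n, η.power n ((ampl E σ b n).toCLM (f n))

variable (E σ)

/-- The generalized `Z`-transform `Φ : f ↦ f^∧`. -/
noncomputable def zTransform : Fock E σ →ₗ[ℂ] (Disc E σ → commutant σ → 𝓔) where
  toFun := pointEval
  map_add' f g := by
    funext η b
    simp only [pointEval, Pi.add_apply]
    rw [← (summable_term η b f).tsum_add (summable_term η b g)]
    simp
  map_smul' c f := by
    funext η b
    simp only [pointEval, Pi.smul_apply, RingHom.id_apply]
    rw [← (summable_term η b f).tsum_const_smul]
    simp

theorem norm_zTransform_le (f : Fock E σ) (η : Disc E σ) (b : commutant σ) :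
    ‖zTransform E σ f η b‖ ≤ (∑' n : ℕ, ‖η.1‖ ^ n * ‖b‖) * ‖f‖ := by
  rw [← tsum_mul_right]
  refine tsum_of_norm_bounded (f := fun n => η.power n ((ampl E σ b n).toCLM (f n)))
    (by simpa only [mul_assoc] using (summable_geom η _).hasSum) (term_norm_le η b f)

theorem isClosed_ker : IsClosed (LinearMap.ker (zTransform E σ) : Set (Fock E σ)) := by
  have h : (LinearMap.ker (zTransform E σ) : Set (Fock E σ)) =
      ⋂ (η : Disc E σ) (b : commutant σ), {f | zTransform E σ f η b = 0} := by
    ext f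
    simp [funext_iff]
  rw [h]
  refine isClosed_iInter fun η => isClosed_iInter fun b => ?_
  let L : Fock E σ →L[ℂ] 𝓔 := LinearMap.mkContinuous
    (LinearMap.proj b ∘ₗ LinearMap.proj η ∘ₗ zTransform E σ) _
    (fun f => norm_zTransform_le E σ f η b)
  exact isClosed_eq (f := fun f => L f) L.continuous continuous_const

/-- The orthogonal projection of the Fock space onto `(ker Φ)^⊥`. -/
noncomputable def initialProj : Fock E σ →L[ℂ] Fock E σ :=
  (LinearMap.ker (zTransform E σ))ᗮ.starProjection

/-- The space `H²(E, σ) = {f^∧ : f ∈ F²(E, σ)}` of functions on `𝔻((E^σ)^*) × σ(A)'`. -/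
def H2 : Type u := LinearMap.range (zTransform E σ)

noncomputable instance : AddCommGroup (H2 E σ) :=
  inferInstanceAs (AddCommGroup (LinearMap.range (zTransform E σ)))

noncomputable instance : Module ℂ (H2 E σ) :=
  inferInstanceAs (Module ℂ (LinearMap.range (zTransform E σ)))

/-- The inclusion of `H²(E, σ)` in the space of all `𝓔`-valued functions on
`𝔻((E^σ)^*) × σ(A)'`. -/
noncomputable def H2.eval : H2 E σ →ₗ[ℂ] (Disc E σ → commutant σ → 𝓔) :=
  (LinearMap.range (zTransform E σ)).subtype

/-- The `Z`-transform as a map onto `H²(E, σ)`. -/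
noncomputable def toH2 : Fock E σ →ₗ[ℂ] H2 E σ := (zTransform E σ).rangeRestrict

theorem ker_le_ker_initialProj :
    LinearMap.ker (zTransform E σ) ≤ LinearMap.ker (initialProj E σ).toLinearMap := fun f hf => by
  rw [LinearMap.mem_ker, ContinuousLinearMap.coe_coe, initialProj,
    Submodule.starProjection_apply_eq_zero_iff]
  exact Submodule.le_orthogonal_orthogonal _ hf

/-- The linear map `f^∧ ↦ P_{(ker Φ)^⊥} f`. -/
noncomputable def H2.lift : H2 E σ →ₗ[ℂ] Fock E σ :=
  (LinearMap.ker (zTransform E σ)).liftQ (initialProj E σ).toLinearMap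
    (ker_le_ker_initialProj E σ) ∘ₗ (zTransform E σ).quotKerEquivRange.symm.toLinearMap

theorem H2.lift_toH2 (f : Fock E σ) : H2.lift E σ (toH2 E σ f) = initialProj E σ f := by
  have : (zTransform E σ).quotKerEquivRange.symm ((zTransform E σ).rangeRestrict f) =
      Submodule.Quotient.mk f := (LinearEquiv.symm_apply_eq _).2 rfl
  exact congrArg ((LinearMap.ker (zTransform E σ)).liftQ (initialProj E σ).toLinearMap
    (ker_le_ker_initialProj E σ)) this

theorem H2.lift_injective : Function.Injective (H2.lift E σ) := by
  rw [injective_iff_map_eq_zero]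
  intro x hx
  obtain ⟨f, rfl⟩ := (zTransform E σ).surjective_rangeRestrict x
  change H2.lift E σ (toH2 E σ f) = 0 at hx
  rw [H2.lift_toH2, initialProj, Submodule.starProjection_apply_eq_zero_iff,
    Submodule.orthogonal_orthogonal_eq_closure,
    (isClosed_ker E σ).submodule_topologicalClosure_eq] at hx
  exact Subtype.ext hx

/-- The norm `‖f^∧‖ = ‖P_{(ker Φ)^⊥} f‖`. -/
noncomputable instance : NormedAddCommGroup (H2 E σ) :=
  NormedAddCommGroup.induced (H2 E σ) (Fock E σ) (H2.lift E σ) (H2.lift_injective E σ)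

noncomputable instance : InnerProductSpace ℂ (H2 E σ) where
  inner x y := ⟪H2.lift E σ x, H2.lift E σ y⟫_ℂ
  norm_smul_le c x := by
    change ‖H2.lift E σ (c • x)‖ ≤ ‖c‖ * ‖H2.lift E σ x‖
    rw [map_smul, norm_smul]
  norm_sq_eq_re_inner x := norm_sq_eq_re_inner (𝕜 := ℂ) (H2.lift E σ x)
  conj_inner_symm x y := inner_conj_symm _ _
  add_left x y z := by rw [map_add, inner_add_left]
  smul_left x y c := by rw [map_smul, inner_smul_left]

instance : CompleteSpace (H2 E σ) := by
  have hi : Isometry (H2.lift E σ) := AddMonoidHomClass.isometry_of_norm _ fun x => rfl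
  have hr : Set.range (H2.lift E σ) =
      ((LinearMap.ker (zTransform E σ))ᗮ : Submodule ℂ (Fock E σ)) := by
    ext f
    constructor
    · rintro ⟨x, rfl⟩
      obtain ⟨f, rfl⟩ := (zTransform E σ).surjective_rangeRestrict x
      change H2.lift E σ (toH2 E σ f) ∈ _
      rw [H2.lift_toH2]
      exact Submodule.starProjection_apply_mem _ _
    · intro hf
      exact ⟨toH2 E σ f, (H2.lift_toH2 E σ f).trans
        (Submodule.starProjection_eq_self_iff.2 hf)⟩
  rw [completeSpace_iff_isComplete_range hi.isUniformInducing, hr]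
  exact (Submodule.isClosed_orthogonal _).isComplete

end Fock

section Kernel

variable {𝓐 : Type*} [CStarAlgebra 𝓐] {Ω : Type*}
  {𝓔 : Type*} [NormedAddCommGroup 𝓔] [InnerProductSpace ℂ 𝓔]

/-- Complete positivity of a kernel `𝕂 : Ω × Ω → L(𝓐, L(𝓔))`:
`∑ᵢⱼ ⟨𝕂(ωᵢ, ωⱼ)[aᵢ* aⱼ] eⱼ, eᵢ⟩ ≥ 0` for all finite families. -/
def IsCompletelyPositiveKernel (𝕂 : Ω → Ω → 𝓐 →L[ℂ] 𝓔 →L[ℂ] 𝓔) : Prop :=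
  ∀ (N : ℕ) (ω : Fin N → Ω) (a : Fin N → 𝓐) (e : Fin N → 𝓔),
    0 ≤ ∑ i, ∑ j, ⟪e i, 𝕂 (ω i) (ω j) (star (a i) * a j) (e j)⟫_ℂ

/-- `H`, whose elements are regarded as `𝓔`-valued functions on `Ω × 𝓐` through `ev`, is a
reproducing kernel Hilbert correspondence over `𝓐` with `*`-representation `π` and reproducing
kernel `𝕂`. -/
structure IsReproducingKernelHilbertCorrespondence {H : Type*} [NormedAddCommGroup H]
    [InnerProductSpace ℂ H] [CompleteSpace H] (ev : H →ₗ[ℂ] (Ω → 𝓐 → 𝓔))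
    (π : 𝓐 →⋆ₐ[ℂ] (H →L[ℂ] H)) (𝕂 : Ω → Ω → 𝓐 →L[ℂ] 𝓔 →L[ℂ] 𝓔) : Prop where
  /-- the elements of `H` are functions -/
  injective : Function.Injective ev
  /-- `(π(a) f)(ω', a') = f(ω', a' a)` -/
  rep_apply : ∀ (a : 𝓐) (f : H) (ω' : Ω) (a' : 𝓐), ev (π a f) ω' a' = ev f ω' (a' * a)
  /-- `k_ω e : (ω', a') ↦ 𝕂(ω', ω)[a'] e` belongs to `H`, and
  `⟨f, π(a)^* k_ω e⟩ = ⟨f(ω, a), e⟩` -/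
  reproducing : ∀ (ω : Ω) (e : 𝓔), ∃ k : H, (∀ ω' a', ev k ω' a' = 𝕂 ω' ω a' e) ∧
    ∀ (f : H) (a : 𝓐), ⟪ContinuousLinearMap.adjoint (π a) k, f⟫_ℂ = ⟪e, ev f ω a⟫_ℂ

end Kernel

end FockHardy

open FockHardy

namespace FockHardy

/-! Everything is done on the Fock space and carried to `H2` by Φ. Since `I_E ⊗ ·` is functorial,
linear and respects adjoints, `b ↦ ι(b)` is a unital `*`-representation of `σ(A)'` on the Fock
space. The identity `(ι(b) f)^∧(η, b') = f^∧(η, b'b)` (`zTransform_iota`) shows that `ker Φ` is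
invariant under every `ι(b)`. As the family is closed under adjoints, `ker Φ` even reduces it, so
`ι` descends to the quotient, which is `H2`.

The norm of `H2` is that of `(ker Φ)^⊥`, so `Φ^*` is the isometric lift onto `(ker Φ)^⊥` and `ΦΦ^* =
1`. The representation is then `π(b) = Φ ι(b) Φ^*`, and it satisfies `π(b) Φ = Φ ι(b)`
(`compress_toH2L`).

For the kernel, `‖ζⁿ‖ ≤ ‖ζ‖ⁿ` puts the coherent vector `c_ζ e = ⨁ (ζⁿ)^* e` in the Fock space.
Moving `ζⁿ` across the inner product gives `⟨ι(b) f, c_ζ e⟩ = ⟨f^∧(ζ, b), e⟩`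
(`coherent_inner_iota`). Hence `c_ζ e` is orthogonal to `ker Φ`, its image under Φ reproduces point
values, and the values of that image are the Szegő sum. The kernel is a Gram kernel of the vectors
`ι(b) c_ζ e`, hence completely positive. -/

theorem ModuleMap.apply_rep {A : Type v} [CStarAlgebra A] {V W : HilbertRep.{u} A}
    (T : ModuleMap V W) (a : A) (x : V.carrier) :
    T.toCLM (V.rep a x) = W.rep a (T.toCLM x) :=
  congrArg (fun S => S x) (T.map_rep a)

/-! ### Functoriality of `I_E ⊗ ·` on module maps. -/

section Amplify

variable {A : Type v} [CStarAlgebra A] [PartialOrder A] [StarOrderedRing A]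
  (E : Type u) [NormedAddCommGroup E] [NormedSpace ℂ E] [CompleteSpace E] [Module A E]
  [Module Aᵐᵒᵖ E] [SMulCommClass A Aᵐᵒᵖ E] [IsScalarTower ℂ A E] [IsScalarTower ℂ Aᵐᵒᵖ E]
  [Correspondence A E] {V W Z : HilbertRep.{u} A}

open UniformSpace (Completion)

theorem amplify_coe (T : ModuleMap V W) (x : PreTensor E V) :
    (preAmplify E T).completion (x : Completion (PreTensor E V)) =
      (preAmplify E T x : Completion (PreTensor E W)) :=
  ContinuousLinearMap.completion_apply_coe _ _

/-- Here and in the next three lemmas the relation is assumed only between underlying operators.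
`ModuleMap` then needs no algebraic structure of its own, and the induction hypotheses for `ampl`
fit as they stand. Both sides are bounded, so the algebraic tensor product suffices. -/
theorem amplify_comp {R : ModuleMap V Z} {S : ModuleMap W Z} {T : ModuleMap V W}
    (h : R.toCLM = S.toCLM ∘L T.toCLM) :
    (amplify E R).toCLM = (amplify E S).toCLM ∘L (amplify E T).toCLM := by
  refine completion_ext fun x => ?_
  change (preAmplify E R).completion _ =
    (preAmplify E S).completion ((preAmplify E T).completion _)
  rw [amplify_coe, amplify_coe, amplify_coe]
  congr 1
  change R.toCLM.toLinearMap.lTensor E x =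
    S.toCLM.toLinearMap.lTensor E (T.toCLM.toLinearMap.lTensor E x)
  rw [h]
  exact LinearMap.lTensor_comp_apply E _ _ x

theorem amplify_add {R S T : ModuleMap V W} (h : R.toCLM = S.toCLM + T.toCLM) :
    (amplify E R).toCLM = (amplify E S).toCLM + (amplify E T).toCLM := by
  refine completion_ext fun x => ?_
  change (preAmplify E R).completion _ =
    (preAmplify E S).completion _ + (preAmplify E T).completion _
  rw [amplify_coe, amplify_coe, amplify_coe, ← Completion.coe_add]
  congr 1
  change R.toCLM.toLinearMap.lTensor E x =
    S.toCLM.toLinearMap.lTensor E x + T.toCLM.toLinearMap.lTensor E x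
  rw [h]
  exact congrArg (fun f : E ⊗[ℂ] V.carrier →ₗ[ℂ] E ⊗[ℂ] W.carrier => f x)
    (LinearMap.lTensor_add E _ _)

theorem amplify_smul {S T : ModuleMap V W} (c : ℂ) (h : S.toCLM = c • T.toCLM) :
    (amplify E S).toCLM = c • (amplify E T).toCLM := by
  refine completion_ext fun x => ?_
  change (preAmplify E S).completion _ = c • (preAmplify E T).completion _
  rw [amplify_coe, amplify_coe, ← Completion.coe_smul]
  congr 1
  change S.toCLM.toLinearMap.lTensor E x = c • T.toCLM.toLinearMap.lTensor E x
  rw [h]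
  exact congrArg (fun f : E ⊗[ℂ] V.carrier →ₗ[ℂ] E ⊗[ℂ] W.carrier => f x)
    (LinearMap.lTensor_smul E _ _)

theorem amplify_id {T : ModuleMap V V} (h : T.toCLM = ContinuousLinearMap.id ℂ V.carrier) :
    (amplify E T).toCLM = ContinuousLinearMap.id ℂ (tensor E V).carrier := by
  refine completion_ext fun x => ?_
  change (preAmplify E T).completion _ = _
  rw [amplify_coe]
  refine congrArg _ (?_ : _ = x)
  change T.toCLM.toLinearMap.lTensor E x = x
  rw [h]
  exact LinearMap.lTensor_id_apply E V.carrier x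

/-- On elementary tensors, `S` crosses the inner product as `T`, and `T` then commutes with the
action of the coefficient `⟨e', e⟩` because it is a module map. -/
theorem tensorForm_lTensor {S : ModuleMap V W} {T : ModuleMap W V}
    (h : ∀ x y, ⟪S.toCLM x, y⟫_ℂ = ⟪x, T.toCLM y⟫_ℂ) (x : E ⊗[ℂ] V.carrier)
    (y : E ⊗[ℂ] W.carrier) :
    tensorForm E W (S.toCLM.toLinearMap.lTensor E x) y =
      tensorForm E V x (T.toCLM.toLinearMap.lTensor E y) := by
  induction x using TensorProduct.induction_on with
  | zero => simp
  | add a b ha hb => simp [ha, hb]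
  | tmul e x =>
    induction y using TensorProduct.induction_on with
    | zero => simp
    | add a b ha hb => rw [map_add, map_add, map_add, ha, hb]
    | tmul e' y => simp [tensorForm_tmul, h, T.apply_rep]

/-- Adjointness is phrased through a pair `S`, `T`, so the adjoint need not be bundled as a module
map; the pair of interest is `I ⊗ b` and `I ⊗ b^*`. -/
theorem amplify_inner {S : ModuleMap V W} {T : ModuleMap W V}
    (h : ∀ x y, ⟪S.toCLM x, y⟫_ℂ = ⟪x, T.toCLM y⟫_ℂ) (x : (tensor E V).carrier)
    (y : (tensor E W).carrier) :
    ⟪(amplify E S).toCLM x, y⟫_ℂ = ⟪x, (amplify E T).toCLM y⟫_ℂ := by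
  change Completion (PreTensor E V) at x
  change Completion (PreTensor E W) at y
  change ⟪(preAmplify E S).completion x, y⟫_ℂ = ⟪x, (preAmplify E T).completion y⟫_ℂ
  induction x, y using Completion.induction_on₂ with
  | hp => exact isClosed_eq (by fun_prop) (by fun_prop)
  | ih x y =>
    rw [amplify_coe, amplify_coe, Completion.inner_coe, Completion.inner_coe]
    exact tensorForm_lTensor E h x y

end Amplify

/-! ### The representation `ι` on the Fock space and its invariant subspace `ker Φ`. -/

section Fock

variable {A : Type v} [CStarAlgebra A] [PartialOrder A] [StarOrderedRing A]
  {E : Type u} [NormedAddCommGroup E] [NormedSpace ℂ E] [CompleteSpace E] [Module A E]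
  [Module Aᵐᵒᵖ E] [SMulCommClass A Aᵐᵒᵖ E] [IsScalarTower ℂ A E] [IsScalarTower ℂ Aᵐᵒᵖ E]
  [Correspondence A E]
  {𝓔 : Type u} [NormedAddCommGroup 𝓔] [InnerProductSpace ℂ 𝓔] [CompleteSpace 𝓔]
  {σ : A →⋆ₐ[ℂ] (𝓔 →L[ℂ] 𝓔)}

theorem ampl_mul (b c : commutant σ) (n : ℕ) :
    (ampl E σ (b * c) n).toCLM = (ampl E σ b n).toCLM ∘L (ampl E σ c n).toCLM := by
  induction n with
  | zero => rfl
  | succ n ih => exact amplify_comp E ih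

theorem ampl_add (b c : commutant σ) (n : ℕ) :
    (ampl E σ (b + c) n).toCLM = (ampl E σ b n).toCLM + (ampl E σ c n).toCLM := by
  induction n with
  | zero => rfl
  | succ n ih => exact amplify_add E ih

theorem ampl_smul (c : ℂ) (b : commutant σ) (n : ℕ) :
    (ampl E σ (c • b) n).toCLM = c • (ampl E σ b n).toCLM := by
  induction n with
  | zero => rfl
  | succ n ih => exact amplify_smul E c ih

theorem ampl_one (n : ℕ) :
    (ampl E σ 1 n).toCLM = ContinuousLinearMap.id ℂ (tensorPow E (ofRep σ) n).carrier := by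
  induction n with
  | zero => rfl
  | succ n ih => exact amplify_id E ih

theorem ampl_inner (b : commutant σ) (n : ℕ) (x y : (tensorPow E (ofRep σ) n).carrier) :
    ⟪(ampl E σ b n).toCLM x, y⟫_ℂ = ⟪x, (ampl E σ (star b) n).toCLM y⟫_ℂ := by
  induction n with
  | zero => exact (ContinuousLinearMap.adjoint_inner_right (b : 𝓔 →L[ℂ] 𝓔) x y).symm
  | succ n ih => exact amplify_inner E ih x y

theorem iota_apply (b : commutant σ) (f : Fock E σ) (n : ℕ) :
    iota b f n = (ampl E σ b n).toCLM (f n) := rfl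

theorem iota_mul (b c : commutant σ) : (iota (b * c) : Fock E σ →L[ℂ] Fock E σ) =
    iota b ∘L iota c := by
  ext f n
  simp [iota_apply, ampl_mul]

theorem iota_add (b c : commutant σ) : (iota (b + c) : Fock E σ →L[ℂ] Fock E σ) =
    iota b + iota c := by
  ext f n
  simp [iota_apply, ampl_add]

theorem iota_smul (c : ℂ) (b : commutant σ) : (iota (c • b) : Fock E σ →L[ℂ] Fock E σ) =
    c • iota b := by
  ext f n
  simp [iota_apply, ampl_smul]

theorem iota_one : (iota 1 : Fock E σ →L[ℂ] Fock E σ) = ContinuousLinearMap.id ℂ _ := by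
  ext f n
  simp [iota_apply, ampl_one]

theorem iota_inner (b : commutant σ) (f g : Fock E σ) :
    ⟪iota b f, g⟫_ℂ = ⟪f, iota (star b) g⟫_ℂ := by
  rw [lp.inner_eq_tsum, lp.inner_eq_tsum]
  exact tsum_congr fun n => ampl_inner b n _ _

/-- Holds term by term, from `(I ⊗ b')(I ⊗ b) = I ⊗ b'b`. The second variable of `f^∧` thus turns
`ι(b)` into a right translation. -/
theorem zTransform_iota (b b' : commutant σ) (f : Fock E σ) (η : Disc E σ) :
    zTransform E σ (iota b f) η b' = zTransform E σ f η (b' * b) := by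
  refine tsum_congr fun n => ?_
  rw [iota_apply, ampl_mul]
  rfl

theorem iota_mem_ker (b : commutant σ) {f : Fock E σ}
    (hf : f ∈ LinearMap.ker (zTransform E σ)) : iota b f ∈ LinearMap.ker (zTransform E σ) := by
  rw [LinearMap.mem_ker] at hf ⊢
  funext η b'
  rw [zTransform_iota, hf]
  rfl

theorem iota_mem_ker_orthogonal (b : commutant σ) {f : Fock E σ}
    (hf : f ∈ (LinearMap.ker (zTransform E σ))ᗮ) :
    iota b f ∈ (LinearMap.ker (zTransform E σ))ᗮ := by
  rw [Submodule.mem_orthogonal] at hf ⊢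
  intro g hg
  have := iota_inner (star b) g f
  -- The adjoint of `ι(b)` is `ι(b^*)`, which also preserves the kernel.
  rw [star_star] at this
  rw [← this]
  exact hf _ (iota_mem_ker _ hg)

/-! ### Coherent vectors and the Szegő kernel. -/

/-- The vector `⨁ₙ (ζⁿ)^* e` of the Fock space. -/
noncomputable def coherent (ζ : Disc E σ) (e : 𝓔) : Fock E σ :=
  ⟨fun n => ContinuousLinearMap.adjoint (ζ.power n) e, by
    -- The squared norms are dominated by the geometric series `(‖ζ‖²)ⁿ ‖e‖²`.
    refine memℓp_gen (Summable.of_nonneg_of_le (fun n => by positivity) (fun n => ?_)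
      ((summable_geometric_of_lt_one (sq_nonneg ‖ζ.1‖)
        (pow_lt_one₀ (norm_nonneg _) ζ.2.2 two_ne_zero)).mul_right (‖e‖ ^ 2)))
    rw [ENNReal.toReal_ofNat, Real.rpow_ofNat, ← pow_mul, mul_comm 2 n, pow_mul, ← mul_pow]
    gcongr
    refine ContinuousLinearMap.le_of_opNorm_le _ ?_ e
    rw [LinearIsometryEquiv.norm_map]
    exact ζ.power_norm_le n⟩

theorem coherent_apply (ζ : Disc E σ) (e : 𝓔) (n : ℕ) :
    coherent ζ e n = ContinuousLinearMap.adjoint (ζ.power n) e := rfl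

/-- The reproducing property, already on the Fock space: each `(ζⁿ)^*` moves to the other side, and
continuity of `⟨e, ·⟩` takes it out of the sum. -/
theorem coherent_inner_iota (ζ : Disc E σ) (e : 𝓔) (b : commutant σ) (f : Fock E σ) :
    ⟪coherent ζ e, iota b f⟫_ℂ = ⟪e, zTransform E σ f ζ b⟫_ℂ := by
  rw [lp.inner_eq_tsum]
  refine (tsum_congr fun n => ?_).trans
    ((innerSL ℂ e).hasSum (summable_term ζ b f).hasSum).tsum_eq
  rw [coherent_apply, iota_apply]
  exact ContinuousLinearMap.adjoint_inner_left _ _ _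

theorem coherent_inner (ζ : Disc E σ) (e : 𝓔) (f : Fock E σ) :
    ⟪coherent ζ e, f⟫_ℂ = ⟪e, zTransform E σ f ζ 1⟫_ℂ := by
  rw [← coherent_inner_iota, iota_one]
  rfl

/-- Pairing with a coherent vector is evaluation at `(ζ, 1)`, which vanishes on `ker Φ`. -/
theorem coherent_mem_ker_orthogonal (ζ : Disc E σ) (e : 𝓔) :
    coherent ζ e ∈ (LinearMap.ker (zTransform E σ))ᗮ := by
  rw [Submodule.mem_orthogonal']
  intro f hf
  rw [coherent_inner, LinearMap.mem_ker.1 hf]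
  exact inner_zero_right _

theorem norm_szegoTerm_le (η ζ : Disc E σ) (b : commutant σ) (n : ℕ) :
    ‖η.power n ∘L (ampl E σ b n).toCLM ∘L ContinuousLinearMap.adjoint (ζ.power n)‖ ≤
      ‖η.1‖ ^ n * ‖b‖ := by
  refine (ContinuousLinearMap.opNorm_comp_le _ _).trans ?_
  refine mul_le_mul (η.power_norm_le n) ?_ (norm_nonneg _) (by positivity)
  refine (ContinuousLinearMap.opNorm_comp_le _ _).trans ?_
  rw [LinearIsometryEquiv.norm_map]
  -- The decay of `‖η‖ⁿ` already suffices, so the power of `ζ` is only bounded by one.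
  exact (mul_le_mul (ampl_norm_le b n)
    ((ζ.power_norm_le n).trans (pow_le_one₀ (norm_nonneg _) ζ.2.2.le)) (norm_nonneg _)
    (norm_nonneg _)).trans_eq (mul_one _)

theorem summable_szegoTerm (η ζ : Disc E σ) (b : commutant σ) :
    Summable fun n =>
      η.power n ∘L (ampl E σ b n).toCLM ∘L ContinuousLinearMap.adjoint (ζ.power n) :=
  Summable.of_norm_bounded (summable_geom η _) (norm_szegoTerm_le η ζ b)

/-- The Szegő kernel `𝕂(η, ζ)[b] = ∑ₙ ηⁿ (I ⊗ b) (ζⁿ)^*`. -/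
noncomputable def szegoKernel (η ζ : Disc E σ) : commutant σ →L[ℂ] 𝓔 →L[ℂ] 𝓔 :=
  LinearMap.mkContinuous
    { toFun := fun b => ∑' n,
        η.power n ∘L (ampl E σ b n).toCLM ∘L ContinuousLinearMap.adjoint (ζ.power n)
      map_add' := fun b c => by
        rw [← (summable_szegoTerm η ζ b).tsum_add (summable_szegoTerm η ζ c)]
        refine tsum_congr fun n => ?_
        rw [ampl_add, ContinuousLinearMap.add_comp, ContinuousLinearMap.comp_add]
      map_smul' := fun c b => by
        rw [RingHom.id_apply, ← (summable_szegoTerm η ζ b).tsum_const_smul]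
        refine tsum_congr fun n => ?_
        rw [ampl_smul, ContinuousLinearMap.smul_comp, ContinuousLinearMap.comp_smul] }
    -- A bound uniform in `ζ`, inherited from `norm_szegoTerm_le`.
    (∑' n : ℕ, ‖η.1‖ ^ n) fun b => by
      rw [← tsum_mul_right]
      exact tsum_of_norm_bounded (summable_geom η _).hasSum (norm_szegoTerm_le η ζ b)

theorem hasSum_szegoKernel (η ζ : Disc E σ) (b : commutant σ) :
    HasSum (fun n =>
      η.power n ∘L (ampl E σ b n).toCLM ∘L ContinuousLinearMap.adjoint (ζ.power n))
      (szegoKernel η ζ b) :=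
  (summable_szegoTerm η ζ b).hasSum

theorem zTransform_coherent (η ζ : Disc E σ) (b : commutant σ) (e : 𝓔) :
    zTransform E σ (coherent ζ e) η b = szegoKernel η ζ b e :=
  ((ContinuousLinearMap.apply ℂ 𝓔 e).hasSum (hasSum_szegoKernel η ζ b)).tsum_eq

/-- Since `ι(aᵢ^* aⱼ) = ι(aᵢ)^* ι(aⱼ)`, the double sum is the squared norm of `∑ᵢ ι(aᵢ) c_{ωᵢ} eᵢ`.
-/
theorem szegoKernel_isCompletelyPositive :
    IsCompletelyPositiveKernel (szegoKernel (E := E) (σ := σ)) := by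
  intro N ω a e
  have h : ∀ i j, ⟪e i, szegoKernel (ω i) (ω j) (star (a i) * a j) (e j)⟫_ℂ =
      ⟪iota (a i) (coherent (ω i) (e i)), iota (a j) (coherent (ω j) (e j))⟫_ℂ := fun i j => by
    rw [← zTransform_coherent, ← coherent_inner_iota, iota_inner, iota_mul]
    rfl
  simp_rw [h, ← inner_sum]
  rw [← sum_inner, inner_self_eq_norm_sq_to_K]
  exact pow_nonneg (Complex.zero_le_real.2
    (norm_nonneg (∑ i, iota (a i) (coherent (ω i) (e i))))) 2

/-! ### The coisometry Φ, the representation π and the reproducing property. -/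

variable (E σ)

theorem norm_toH2 (f : Fock E σ) :
    ‖toH2 E σ f‖ = ‖(LinearMap.ker (zTransform E σ))ᗮ.starProjection f‖ := by
  rw [← initialProj, ← H2.lift_toH2]
  rfl

/-- The `Z`-transform as a bounded operator onto `H²(E, σ)`. -/
noncomputable def toH2L : Fock E σ →L[ℂ] H2 E σ :=
  LinearMap.mkContinuous (toH2 E σ) 1 fun f => by
    rw [norm_toH2, one_mul]
    exact Submodule.norm_starProjection_apply_le _ f

theorem toH2L_surjective : Function.Surjective (toH2L E σ) :=
  (zTransform E σ).surjective_rangeRestrict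

/-- With `P` the projection onto `(ker Φ)^⊥`, the inner product of `H2` is `⟨Pf, Pg⟩`, which equals
`⟨Pf, g⟩` because `P` is a self-adjoint idempotent. -/
theorem adjoint_toH2L (x : H2 E σ) :
    ContinuousLinearMap.adjoint (toH2L E σ) x = H2.lift E σ x := by
  refine ext_inner_right ℂ fun g => ?_
  rw [ContinuousLinearMap.adjoint_inner_left]
  change ⟪H2.lift E σ x, H2.lift E σ (toH2 E σ g)⟫_ℂ = _
  obtain ⟨f, rfl⟩ := toH2L_surjective E σ x
  change ⟪H2.lift E σ (toH2 E σ f), _⟫_ℂ = ⟪H2.lift E σ (toH2 E σ f), g⟫_ℂ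
  rw [H2.lift_toH2, H2.lift_toH2, initialProj, Submodule.inner_starProjection_left_eq_right,
    Submodule.starProjection_eq_self_iff.2 (Submodule.starProjection_apply_mem _ _),
    Submodule.inner_starProjection_left_eq_right]

/-- Both sides have lift `Pf`. That the lift determines the function rests on `ker Φ` being closed,
through `H2.lift_injective`. -/
theorem toH2L_initialProj (f : Fock E σ) : toH2L E σ (initialProj E σ f) = toH2L E σ f := by
  apply H2.lift_injective E σ
  change H2.lift E σ (toH2 E σ _) = H2.lift E σ (toH2 E σ _)
  rw [H2.lift_toH2, H2.lift_toH2]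
  exact Submodule.starProjection_eq_self_iff.2 (Submodule.starProjection_apply_mem _ _)

theorem toH2L_comp_adjoint : toH2L E σ ∘L ContinuousLinearMap.adjoint (toH2L E σ) =
    ContinuousLinearMap.id ℂ (H2 E σ) := by
  ext1 x
  obtain ⟨f, rfl⟩ := toH2L_surjective E σ x
  rw [ContinuousLinearMap.comp_apply, adjoint_toH2L]
  change toH2L E σ (H2.lift E σ (toH2 E σ f)) = toH2L E σ f
  rw [H2.lift_toH2, toH2L_initialProj]

theorem toH2L_eq_zero_iff {f : Fock E σ} :
    toH2L E σ f = 0 ↔ f ∈ LinearMap.ker (zTransform E σ) :=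
  Subtype.ext_iff

/-- The compression `Φ ι(b) Φ^*` of `ι(b)` to `H²(E, σ)`. -/
noncomputable def compress (b : commutant σ) : H2 E σ →L[ℂ] H2 E σ :=
  toH2L E σ ∘L iota b ∘L ContinuousLinearMap.adjoint (toH2L E σ)

/-- From `ΦΦ^* = 1`, the vector `Φ^*Φf - f` lies in `ker Φ`, and `ι(b)` keeps it there. -/
theorem compress_toH2L (b : commutant σ) (f : Fock E σ) :
    compress E σ b (toH2L E σ f) = toH2L E σ (iota b f) := by
  change toH2L E σ (iota b (ContinuousLinearMap.adjoint (toH2L E σ) (toH2L E σ f))) = _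
  rw [← sub_eq_zero, ← map_sub, ← map_sub, toH2L_eq_zero_iff]
  refine iota_mem_ker b ?_
  rw [← toH2L_eq_zero_iff, map_sub, sub_eq_zero]
  exact congrArg (fun T => T (toH2L E σ f)) (toH2L_comp_adjoint E σ)

theorem adjoint_iota (b : commutant σ) :
    ContinuousLinearMap.adjoint (iota b : Fock E σ →L[ℂ] Fock E σ) = iota (star b) := by
  symm
  rw [ContinuousLinearMap.eq_adjoint_iff]
  intro f g
  rw [iota_inner, star_star]

/-- The `*`-representation `π` of `σ(A)'` on `H²(E, σ)`. -/
noncomputable def H2.rep : commutant σ →⋆ₐ[ℂ] (H2 E σ →L[ℂ] H2 E σ) :=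
  { AlgHom.ofLinearMap
      ({ toFun := compress E σ
         map_add' := fun b c => by
          rw [compress, iota_add, ContinuousLinearMap.add_comp, ContinuousLinearMap.comp_add]
          rfl
         map_smul' := fun c b => by
          rw [compress, iota_smul, ContinuousLinearMap.smul_comp,
            ContinuousLinearMap.comp_smul]
          rfl } : commutant σ →ₗ[ℂ] (H2 E σ →L[ℂ] H2 E σ))
      (by
        change compress E σ 1 = 1
        rw [compress, iota_one, ContinuousLinearMap.id_comp, toH2L_comp_adjoint]
        rfl)
      (fun b c => by
        -- A compression need not be multiplicative; this one is, because Φ intertwines it with `ι`.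
        change compress E σ (b * c) = compress E σ b * compress E σ c
        ext1 x
        obtain ⟨f, rfl⟩ := toH2L_surjective E σ x
        rw [mul_apply_eq_comp, compress_toH2L, compress_toH2L, compress_toH2L, iota_mul]
        rfl) with
    map_star' := fun b => by
      change compress E σ (star b) = star (compress E σ b)
      -- Here the formula `Φ ι(b) Φ^*` alone suffices.
      rw [ContinuousLinearMap.star_eq_adjoint, compress, compress,
        ContinuousLinearMap.adjoint_comp, ContinuousLinearMap.adjoint_comp,
        ContinuousLinearMap.adjoint_adjoint, adjoint_iota]
      rfl }

theorem H2.rep_toH2 (b : commutant σ) (f : Fock E σ) :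
    H2.rep E σ b (toH2 E σ f) = toH2 E σ (iota b f) :=
  compress_toH2L E σ b f

/-- The projection fixes the coherent vector, so it can be dropped from the inner product of `H2`.
-/
theorem toH2_coherent_inner (ζ : Disc E σ) (e : 𝓔) (f : Fock E σ) :
    ⟪toH2 E σ (coherent ζ e), toH2 E σ f⟫_ℂ = ⟪coherent ζ e, f⟫_ℂ := by
  change ⟪H2.lift E σ (toH2 E σ _), H2.lift E σ (toH2 E σ _)⟫_ℂ = _
  rw [H2.lift_toH2, H2.lift_toH2, initialProj,
    Submodule.starProjection_eq_self_iff.2 (coherent_mem_ker_orthogonal ζ e),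
    ← Submodule.inner_starProjection_left_eq_right,
    Submodule.starProjection_eq_self_iff.2 (coherent_mem_ker_orthogonal ζ e)]

theorem H2.isReproducingKernelHilbertCorrespondence :
    IsReproducingKernelHilbertCorrespondence (H2.eval E σ) (H2.rep E σ) szegoKernel where
  injective := Subtype.val_injective
  rep_apply b x η b' := by
    obtain ⟨f, rfl⟩ := toH2L_surjective E σ x
    change H2.eval E σ (H2.rep E σ b (toH2 E σ f)) η b' = _
    rw [H2.rep_toH2]
    exact zTransform_iota b b' f η
  reproducing ζ e := by
    -- The kernel function is the image of the coherent vector; moving `π(b)^*` to the other side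
    -- reduces the claim to `coherent_inner_iota`.
    refine ⟨toH2 E σ (coherent ζ e), fun η b => zTransform_coherent η ζ b e, fun x b => ?_⟩
    obtain ⟨f, rfl⟩ := toH2L_surjective E σ x
    rw [ContinuousLinearMap.adjoint_inner_left]
    change ⟪_, H2.rep E σ b (toH2 E σ f)⟫_ℂ = _
    rw [H2.rep_toH2, toH2_coherent_inner, coherent_inner_iota]
    rfl

end Fock

end FockHardy

theorem theorem4p1 {A : Type v} [CStarAlgebra A] [PartialOrder A] [StarOrderedRing A]
    [WStarAlgebra A]
    {E : Type u} [NormedAddCommGroup E] [NormedSpace ℂ E] [CompleteSpace E]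
    [Module A E] [Module Aᵐᵒᵖ E] [SMulCommClass A Aᵐᵒᵖ E]
    [IsScalarTower ℂ A E] [IsScalarTower ℂ Aᵐᵒᵖ E] [Correspondence A E]
    (hE : IsSelfDual A E)
    {𝓔 : Type u} [NormedAddCommGroup 𝓔] [InnerProductSpace ℂ 𝓔] [CompleteSpace 𝓔]
    (σ : A →⋆ₐ[ℂ] (𝓔 →L[ℂ] 𝓔)) :
    -- `f^∧(η, b) = ∑ₙ ηⁿ (I ⊗ b) fₙ`, with convergence
    (∀ (f : Fock E σ) (η : Disc E σ) (b : commutant σ),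
      HasSum (fun n => η.power n ((ampl E σ b n).toCLM (f n))) (H2.eval E σ (toH2 E σ f) η b)) ∧
    -- `Φ : f ↦ f^∧` is a coisometry of `F²(E, σ)` onto `H²(E, σ)`
    (∃ Φ : Fock E σ →L[ℂ] H2 E σ, (∀ f, Φ f = toH2 E σ f) ∧
      Φ ∘L ContinuousLinearMap.adjoint Φ = ContinuousLinearMap.id ℂ (H2 E σ)) ∧
    (∀ f : Fock E σ, ‖toH2 E σ f‖ = ‖(LinearMap.ker (zTransform E σ))ᗮ.starProjection f‖) ∧
    -- `H²(E, σ)` is a reproducing kernel Hilbert correspondence over `σ(A)'`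
    ∃ (π : commutant σ →⋆ₐ[ℂ] (H2 E σ →L[ℂ] H2 E σ))
      (𝕂 : Disc E σ → Disc E σ → commutant σ →L[ℂ] 𝓔 →L[ℂ] 𝓔),
      IsReproducingKernelHilbertCorrespondence (H2.eval E σ) π 𝕂 ∧
      (∀ (b b' : commutant σ) (f : Fock E σ) (η' : Disc E σ),
        H2.eval E σ (π b (toH2 E σ f)) η' b' = zTransform E σ (iota b f) η' b') ∧
      IsCompletelyPositiveKernel 𝕂 ∧
      -- the kernel is the Szegő kernel `∑ₙ ηⁿ (I ⊗ b) (ζⁿ)^*`, convergent in operator norm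
      ∀ (η ζ : Disc E σ) (b : commutant σ),
        HasSum (fun n => η.power n ∘L (ampl E σ b n).toCLM ∘L
          ContinuousLinearMap.adjoint (ζ.power n)) (𝕂 η ζ b) := by
  refine ⟨fun f η b => (summable_term η b f).hasSum,
    ⟨toH2L E σ, fun _ => rfl, toH2L_comp_adjoint E σ⟩, norm_toH2 E σ, H2.rep E σ, szegoKernel,
    H2.isReproducingKernelHilbertCorrespondence E σ, fun b b' f η => ?_,
    szegoKernel_isCompletelyPositive, hasSum_szegoKernel⟩
  rw [H2.rep_toH2]
  rfl
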